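/- Let $M\ge 3$ be an integer, $a>0$, $\mu\in\mathbb R$, $g\in\mathbb R\setminus\{0\}$, and let $\alpha>0$ with $\alpha\neq \frac1{2a}$. For $k,m\in\{0,\dots,M-1\}$ put $\theta_m=2\pi m/M$ and $\Delta_{km}=\theta_k-\theta_m$, and for $t>0$, $\theta\in\mathbb R$ put $$\Gamma_m(t,\theta)=g\,t^{2\mu-1}e^{2a(\theta-\theta_m)},\qquad \zeta_m^{\pm}(t,\theta)=e^{\pm i\alpha\ln(\Gamma_m(t,\theta)/g)}=e^{\pm i\alpha(2a(\theta-\theta_m)+(2\mu-1)\ln t)} .$$ Let $X_k,Y_k:(0,\infty)\to\mathbb C$ $(k=0,\dots,M-1)$ satisfy, for all $t>0$, $$\sum_{k=0}^{M-1}X_k(t)e^{-i\theta_k}=\sum_{k=0}^{M-1}Y_k(t)e^{-i\theta_k}=0,\qquad \sum_{k=0}^{M-1}X_k(t)e^{-2i\theta_k}=\sum_{k=0}^{M-1}Y_k(t)e^{-2i\theta_k}=0,$$ and let $\zeta_m(t,\theta)=X_m(t)\zeta_m^+(t,\theta)e^{i\theta}+Y_m(t)\zeta_m^-(t,\theta)e^{i\theta}$.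 Define $$\mathcal J_m\zeta(t,\theta)=\frac{ag}{\pi i}\,\mathrm{f.p.}\!\int_{-\infty}^{\infty}\sum_{k=0}^{M-1}\frac{\zeta_k(t,\sigma+\theta+\Delta_{km})\,e^{2a\sigma}e^{-2i\theta}}{\left(1-e^{(a+i)\sigma}e^{i\Delta_{km}}\right)^2}\,d\sigma .$$ Here, for an integrand $F$ with a second-order singularity at $\sigma=0$, and $R_1,R_2>0$, the Hadamard finite part is $$\mathrm{f.p.}\!\int_{-R_1}^{R_2}F\,d\sigma=\lim_{\varepsilon\to0^+}\Big(\int_{-R_1}^{-\varepsilon}F\,d\sigma+\int_{\varepsilon}^{R_2}F\,d\sigma-\varepsilon\big(F(\varepsilon)+F(-\varepsilon)\big)\Big),$$ and $\mathrm{f.p.}\int_{-\infty}^{\infty}F\,d\sigma$ is its limit as $R_1,R_2\to\infty$. Define further $$B_\pm=-a(\pm2i\alpha+1)\frac{1+ai}{1+a^2},\qquad c_{mk}^{\pm}=\frac{a^2(\pm2i\alpha+1)}{(a+i)^2}\,\frac{\mathcal B_{mk}^{\pm}}{\sinh(\pi B_\pm)},$$ where $\mathcal B_{mk}^{\pm}=e^{\Delta_{km}B_\pm}\cdot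 e^{-\pi B_\pm}$ if $\Delta_{km}>0$, $\mathcal B_{mk}^{\pm}=\cosh(\pi B_\pm)$ if $\Delta_{km}=0$, and $\mathcal B_{mk}^{\pm}=e^{\Delta_{km}B_\pm}\cdot e^{\pi B_\pm}$ if $\Delta_{km}<0$. Then, for all $m\in\{0,\dots,M-1\}$, $t>0$ and $\theta\in\mathbb R$, the finite part defining $\mathcal J_m\zeta(t,\theta)$ exists and $$\mathcal J_m\zeta(t,\theta)=\zeta_m^+(t,\theta)\,e^{-i\theta}\,g\sum_{k=0}^{M-1}X_k(t)\,c_{mk}^{+}+\zeta_m^-(t,\theta)\,e^{-i\theta}\,g\sum_{k=0}^{M-1}Y_k(t)\,c_{mk}^{-}.$$ -/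

import Mathlib

open Filter Topology

noncomputable section

namespace LogSpiral

/-! ### Hadamard finite part -/

/-- `HasFinitePart F x a b L`: the finite part over `[a, b]` of the integrand `F`, which may have
a second-order singularity at the interior point `x`, exists and equals `L`.
Writing `F t = f t / (t - x) ^ 2`, the subtracted term `ε * (F (x + ε) + F (x - ε))` is the usual
`(f (x + ε) + f (x - ε)) / ε`, see `hasFinitePart_div_sq` and `hasFinitePart_curve` below. -/
def HasFinitePart (F : ℝ → ℂ) (x a b : ℝ) (L : ℂ) : Prop :=
  Tendsto
    (fun ε : ℝ => (∫ t in a..(x - ε), F t) + (∫ t in (x + ε)..b, F t)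
      - (ε : ℂ) * (F (x + ε) + F (x - ε)))
    (𝓝[>] 0) (𝓝 L)

/-- For an integrand `f t / (t - x) ^ 2` this is Hadamard's regularization
`lim (∫_a^{x-ε} + ∫_{x+ε}^b) f t / (t - x) ^ 2 dt - (f (x + ε) + f (x - ε)) / ε`. -/
theorem hasFinitePart_div_sq (f : ℝ → ℂ) (x a b : ℝ) (L : ℂ) :
    HasFinitePart (fun t => f t / ((t : ℂ) - x) ^ 2) x a b L ↔
      Tendsto
        (fun ε : ℝ => (∫ t in a..(x - ε), f t / ((t : ℂ) - x) ^ 2)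
          + (∫ t in (x + ε)..b, f t / ((t : ℂ) - x) ^ 2)
          - (f (x + ε) + f (x - ε)) / (ε : ℂ))
        (𝓝[>] 0) (𝓝 L) := by
  unfold HasFinitePart
  refine tendsto_congr' ?_
  filter_upwards [self_mem_nhdsWithin] with ε hε
  have h : (ε : ℂ) ≠ 0 := by exact_mod_cast (ne_of_gt hε)
  congr 1
  push_cast
  have h1 : ((x : ℂ) + ε - x) = ε := by ring
  have h2 : ((x : ℂ) - ε - x) = -ε := by ring
  rw [h1, h2]
  field_simp

/-- For an integrand `f t / (γ t - γ x) ^ 2` along a curve, this is the finite part of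
`g t / (t - x) ^ 2` with `g t = f t * ((γ t - γ x) / (t - x)) ^ (-2)`. -/
theorem hasFinitePart_curve (f γ : ℝ → ℂ) (x a b : ℝ) (L : ℂ) :
    HasFinitePart (fun t => f t / (γ t - γ x) ^ 2) x a b L ↔
      HasFinitePart
        (fun t => f t * ((γ t - γ x) / ((t : ℂ) - x)) ^ (-2 : ℤ) / ((t : ℂ) - x) ^ 2)
        x a b L := by
  have key : (fun t : ℝ => f t * ((γ t - γ x) / ((t : ℂ) - x)) ^ (-2 : ℤ) / ((t : ℂ) - x) ^ 2)
      = fun t => f t / (γ t - γ x) ^ 2 := by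
    funext t
    by_cases ht : t = x
    · subst ht; simp
    · have h : (t : ℂ) - x ≠ 0 := by
        rw [sub_ne_zero]; exact_mod_cast ht
      rw [zpow_neg, ← inv_zpow, inv_div]
      norm_cast
      rw [div_pow]
      push_cast
      field_simp
  rw [key]

/-- The finite part over the whole line, improper at both ends: the finite part exists over every
`[a, b]` containing `x` in its interior, and these converge as `a → -∞` and `b → ∞`
independently of each other. -/
def HasFinitePartLine (F : ℝ → ℂ) (x : ℝ) (L : ℂ) : Prop :=
  ∃ V : ℝ → ℝ → ℂ, (∀ a b : ℝ, a < x → x < b → HasFinitePart F x a b (V a b)) ∧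
    Tendsto (fun p : ℝ × ℝ => V p.1 p.2) (atBot ×ˢ atTop) (𝓝 L)

open Classical in
/-- The value of the finite part over the line (`0` if it does not exist). -/
def finitePartLine (F : ℝ → ℂ) (x : ℝ) : ℂ :=
  if h : ∃ L, HasFinitePartLine F x L then h.choose else 0

/-! ### Alexander spirals -/

/-- The angles `θ_m = 2πm/M`. -/
def angle (M : ℕ) (m : Fin M) : ℝ := 2 * Real.pi * (m : ℝ) / M

/-- `Δ_{km} = θ_k - θ_m`. -/
def angleDiff (M : ℕ) (k m : Fin M) : ℝ := angle M k - angle M m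

/-- The circulation `Γ_m(t,θ) = g t^{2μ-1} e^{2a(θ-θ_m)}`. -/
def circulation (a g μ : ℝ) (M : ℕ) (m : Fin M) (t θ : ℝ) : ℝ :=
  g * t ^ (2 * μ - 1) * Real.exp (2 * a * (θ - angle M m))

/-- The oscillations `ζ_m^±(t,θ) = exp(± iα ln(Γ_m(t,θ)/g))`; `s = 1` gives `ζ_m^+` and
`s = -1` gives `ζ_m^-`. -/
def mode (a g μ α : ℝ) (M : ℕ) (s : ℝ) (m : Fin M) (t θ : ℝ) : ℂ :=
  Complex.exp (s * Complex.I * α * (Real.log (circulation a g μ M m t θ / g) : ℝ))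

/-- `ζ_m^±(t,θ) = exp(± iα(2a(θ-θ_m) + (2μ-1) ln t))`. -/
theorem mode_eq (a g μ α : ℝ) (hg : g ≠ 0) (M : ℕ) (s : ℝ) (m : Fin M) (t θ : ℝ) (ht : 0 < t) :
    mode a g μ α M s m t θ = Complex.exp (s * Complex.I * α *
      ((2 * a * (θ - angle M m) + (2 * μ - 1) * Real.log t : ℝ) : ℂ)) := by
  have h : circulation a g μ M m t θ / g
      = t ^ (2 * μ - 1) * Real.exp (2 * a * (θ - angle M m)) := by
    unfold circulation
    field_simp
  unfold mode
  rw [h, Real.log_mul (Real.rpow_pos_of_pos ht _).ne' (Real.exp_pos _).ne', Real.log_exp,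
    Real.log_rpow ht, add_comm]

/-- The perturbation `ζ_m(t,θ) = X_m(t) ζ_m^+(t,θ) e^{iθ} + Y_m(t) ζ_m^-(t,θ) e^{iθ}`. -/
def perturbation (a g μ α : ℝ) (M : ℕ) (X Y : Fin M → ℝ → ℂ) (m : Fin M) (t θ : ℝ) : ℂ :=
  X m t * mode a g μ α M 1 m t θ * Complex.exp (Complex.I * θ)
    + Y m t * mode a g μ α M (-1) m t θ * Complex.exp (Complex.I * θ)

/-! ### The off-diagonal operator -/

/-- The integrand
`∑_k ζ_k(σ+θ+Δ_{km}) e^{2aσ} e^{-2iθ} / (1 - e^{(a+i)σ} e^{iΔ_{km}})²`,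
with `ζ = (ζ_0, …, ζ_{M-1})` functions of the angle. Only the term `k = m` is singular, at
`σ = 0`. -/
def offDiagIntegrand (a : ℝ) (M : ℕ) (ζ : Fin M → ℝ → ℂ) (m : Fin M) (θ σ : ℝ) : ℂ :=
  ∑ k : Fin M, ζ k (σ + θ + angleDiff M k m) * Complex.exp (2 * a * σ)
      * Complex.exp (-2 * Complex.I * θ)
    / (1 - Complex.exp ((a + Complex.I) * σ) * Complex.exp (Complex.I * angleDiff M k m)) ^ 2

/-- `(J_m ζ)(θ) = (a g / (π i)) f.p. ∫_{-∞}^{∞} (integrand) dσ`. -/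
def offDiagOp (a g : ℝ) (M : ℕ) (ζ : Fin M → ℝ → ℂ) (m : Fin M) (θ : ℝ) : ℂ :=
  a * g / (Real.pi * Complex.I) * finitePartLine (offDiagIntegrand a M ζ m θ) 0

/-! ### The coefficients -/

/-- `B_± = -a (±2iα + 1) (1 + ai) / (1 + a²)`; `s = 1` gives `B_+`, `s = -1` gives `B_-`. -/
def expB (a α s : ℝ) : ℂ :=
  -a * (s * 2 * Complex.I * α + 1) * ((1 + a * Complex.I) / (1 + (a : ℂ) ^ 2))

/-- The numbers `𝓑^±_{mk}`. -/
def coeffB (a α : ℝ) (M : ℕ) (s : ℝ) (m k : Fin M) : ℂ :=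
  Complex.exp (angleDiff M k m * expB a α s) *
    (if 0 < angleDiff M k m then Complex.exp (-Real.pi * expB a α s)
     else if angleDiff M k m = 0 then Complex.cosh (Real.pi * expB a α s)
     else Complex.exp (Real.pi * expB a α s))

/-- `c^±_{mk} = a² (±2iα + 1) / (a + i)² * 𝓑^±_{mk} / sinh(π B_±)`. -/
def coeffC (a α : ℝ) (M : ℕ) (s : ℝ) (m k : Fin M) : ℂ :=
  (a : ℂ) ^ 2 * (s * 2 * Complex.I * α + 1) / (a + Complex.I) ^ 2
    * (coeffB a α M s m k / Complex.sinh (Real.pi * expB a α s))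

/-- The perturbation compatibility conditions for one family:
`∑_k X_k(t) e^{-iθ_k} = 0` and `∑_k X_k(t) e^{-2iθ_k} = 0` for all `t > 0`. -/
def Compatible (M : ℕ) (X : Fin M → ℝ → ℂ) : Prop :=
  ∀ t : ℝ, 0 < t →
    ∑ k : Fin M, X k t * Complex.exp (-Complex.I * angle M k) = 0 ∧
    ∑ k : Fin M, X k t * Complex.exp (-2 * Complex.I * angle M k) = 0

end LogSpiral

end

namespace LogSpiral

/-! ### Calculus of finite parts -/

/-! Put `β = spiralExponent a α s` and `v = (a + i) σ + i Δ_{km}`. Each term of the integrand splits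
into two modes, each a factor independent of `σ` times `kernel β v` (`offDiagIntegrand_term`), so
everything reduces to finite parts of one meromorphic function along parallel lines. These lines lie
in a strip whose only pole is the origin, with principal part `v⁻² + β v⁻¹`. Moving the line through
the origin to one side or the other changes the finite part by half a residue term, `∓ iπβ`
(`exists_primitives`).

The kernel decays at the lower end. At the upper end it approaches `e^{(β-1)v}`, which has constant
modulus along each line, so a purely oscillating primitive must be split off. The lines `δ = π` and
`δ = -π` differ by the translation `2πi`, which multiplies the kernel by `q = e^{2πiβ}`. Together
with the half-residue jumps this is a linear equation for the value on the central line, with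
solution `iπβ (1 + q) / (1 - q)` (`exists_hasFinitePart_kernel`). It is solvable because `β` is not
an integer, which for `s = 1` is the condition `α ≠ 1/(2a)`.

In the sum over `k` the condition `∑ X_k e^{-iθ_k} = 0` cancels the oscillations
(`hasFinitePartLine_kernelSum`). Since `q = e^{-2πB}`, the value is a multiple of `coth (πB) - sign
Δ_{km}`, which is the three-case coefficient (`coeffC_eq`). -/

theorem HasFinitePart.unique {F : ℝ → ℂ} {x a b : ℝ} {L L' : ℂ}
    (h : HasFinitePart F x a b L) (h' : HasFinitePart F x a b L') : L = L' :=
  tendsto_nhds_unique h h'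

theorem HasFinitePart.const_mul {F : ℝ → ℂ} {x a b : ℝ} {L : ℂ} (c : ℂ)
    (h : HasFinitePart F x a b L) : HasFinitePart (fun t => c * F t) x a b (c * L) := by
  unfold HasFinitePart at h ⊢
  refine (h.const_mul c).congr fun ε => ?_
  simp only [intervalIntegral.integral_const_mul]
  ring

theorem HasFinitePart.sum {ι : Type*} (s : Finset ι) {F : ι → ℝ → ℂ} {x a b : ℝ} {L : ι → ℂ}
    (ha : a < x) (hb : x < b) (hF : ∀ i ∈ s, ContinuousOn (F i) {x}ᶜ)
    (h : ∀ i ∈ s, HasFinitePart (F i) x a b (L i)) :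
    HasFinitePart (fun t => ∑ i ∈ s, F i t) x a b (∑ i ∈ s, L i) := by
  unfold HasFinitePart at h ⊢
  refine (tendsto_finsetSum s h).congr' ?_
  filter_upwards [self_mem_nhdsWithin] with ε hε
  have hε : 0 < ε := hε
  have hl (i) (hi : i ∈ s) (ha' : a < x) :
      IntervalIntegrable (F i) MeasureTheory.volume a (x - ε) := by
    refine ((hF i hi).mono fun t ht => ?_).intervalIntegrable
    have : t ≤ max a (x - ε) := ht.2
    have h2 : max a (x - ε) < x := max_lt ha (by linarith)
    exact ne_of_lt (lt_of_le_of_lt this h2)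
  have hr (i) (hi : i ∈ s) : IntervalIntegrable (F i) MeasureTheory.volume (x + ε) b := by
    refine ((hF i hi).mono fun t ht => ?_).intervalIntegrable
    have : min (x + ε) b ≤ t := ht.1
    have h2 : x < min (x + ε) b := lt_min (by linarith) hb
    exact ne_of_gt (lt_of_lt_of_le h2 this)
  rw [intervalIntegral.integral_finsetSum fun i hi => hl i hi ha,
    intervalIntegral.integral_finsetSum fun i hi => hr i hi]
  simp only [Finset.sum_sub_distrib, Finset.sum_add_distrib, ← Finset.mul_sum]

/-- A finite part computed from primitives on both sides of the singularity. -/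
theorem hasFinitePart_of_hasDerivAt {F Φ Ψ : ℝ → ℂ} {x a b : ℝ} (ha : a < x) (hb : x < b)
    (hF : ContinuousOn F {x}ᶜ) (hΦ : ∀ t < x, HasDerivAt Φ (F t) t)
    (hΨ : ∀ t, x < t → HasDerivAt Ψ (F t) t) {c : ℂ}
    (hc : Tendsto (fun ε : ℝ => Φ (x - ε) - Ψ (x + ε) - (ε : ℂ) * (F (x + ε) + F (x - ε)))
      (𝓝[>] 0) (𝓝 c)) :
    HasFinitePart F x a b (Ψ b - Φ a + c) := by
  unfold HasFinitePart
  refine (hc.const_add (Ψ b - Φ a)).congr' ?_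
  filter_upwards [self_mem_nhdsWithin] with ε hε
  have hε : 0 < ε := hε
  have hl : ∀ t ∈ Set.uIcc a (x - ε), t < x := fun t ht =>
    lt_of_le_of_lt ht.2 (max_lt ha (by linarith))
  have hr : ∀ t ∈ Set.uIcc (x + ε) b, x < t := fun t ht =>
    lt_of_lt_of_le (lt_min (by linarith) hb) ht.1
  rw [intervalIntegral.integral_eq_sub_of_hasDerivAt (fun t ht => hΦ t (hl t ht))
      (hF.mono fun t ht => (hl t ht).ne).intervalIntegrable,
    intervalIntegral.integral_eq_sub_of_hasDerivAt (fun t ht => hΨ t (hr t ht))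
      (hF.mono fun t ht => (hr t ht).ne').intervalIntegrable]
  ring

theorem HasFinitePartLine.unique {F : ℝ → ℂ} {x : ℝ} {L L' : ℂ}
    (h : HasFinitePartLine F x L) (h' : HasFinitePartLine F x L') : L = L' := by
  obtain ⟨V, hV, hL⟩ := h
  obtain ⟨V', hV', hL'⟩ := h'
  refine tendsto_nhds_unique hL (hL'.congr' ?_)
  filter_upwards [prod_mem_prod (Iio_mem_atBot x) (Ioi_mem_atTop x)] with ⟨a, b⟩ ⟨ha, hb⟩
  exact (hV' a b ha hb).unique (hV a b ha hb)

theorem HasFinitePartLine.finitePartLine_eq {F : ℝ → ℂ} {x : ℝ} {L : ℂ}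
    (h : HasFinitePartLine F x L) : finitePartLine F x = L := by
  have hex : ∃ L, HasFinitePartLine F x L := ⟨L, h⟩
  unfold finitePartLine
  rw [dif_pos hex]
  exact hex.choose_spec.unique h

/-! ### The kernel and its singularity at the origin -/

/-- `e^{(β+1)v} / (1 - e^v)²`. -/
noncomputable def kernel (β v : ℂ) : ℂ := Complex.exp ((β + 1) * v) / (1 - Complex.exp v) ^ 2

/-- The strip `|Im v - Re v / a| < 2π` around the line through the origin in direction `a + i`. -/
def slantedStrip (a : ℝ) : Set ℂ := {v | |v.im - v.re / a| < 2 * Real.pi}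

theorem isOpen_slantedStrip (a : ℝ) : IsOpen (slantedStrip a) :=
  isOpen_lt (by fun_prop) continuous_const

/-- Convexity gives holomorphic functions on the strip a primitive and permits the mean value
inequality there. -/
theorem convex_slantedStrip (a : ℝ) : Convex ℝ (slantedStrip a) := by
  intro v hv w hw s t hs ht hst
  simp only [slantedStrip, Set.mem_ofPred_eq, abs_lt] at *
  have e : (s • v + t • w).im - (s • v + t • w).re / a
      = s * (v.im - v.re / a) + t * (w.im - w.re / a) := by
    simp; ring
  rw [e]
  obtain rfl : t = 1 - s := by linarith
  rcases hs.eq_or_lt with rfl | hs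
  · constructor <;> linarith
  · constructor <;> nlinarith [hv.1, hv.2, hw.1, hw.2]

theorem zero_mem_slantedStrip (a : ℝ) : (0 : ℂ) ∈ slantedStrip a := by
  simp [slantedStrip, Real.pi_pos]

/-- The zeros `2πin` of `e^v - 1` have `Im v - Re v / a = 2πn`, so only `n = 0` fits in the strip.
-/
theorem exp_ne_one_of_mem_slantedStrip {a : ℝ} {v : ℂ} (hv : v ∈ slantedStrip a) (h0 : v ≠ 0) :
    Complex.exp v ≠ 1 := by
  intro h
  obtain ⟨n, rfl⟩ := Complex.exp_eq_one_iff.1 h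
  have : |(n : ℝ) * (2 * Real.pi)| < 2 * Real.pi := by simpa [slantedStrip] using hv
  rw [abs_mul, abs_of_pos Real.two_pi_pos] at this
  have h1 : |(n : ℝ)| < 1 := by
    by_contra hcon
    push Not at hcon
    nlinarith [Real.two_pi_pos]
  have h2 : |n| < 1 := by exact_mod_cast h1
  have : n = 0 := Int.abs_lt_one_iff.1 h2
  simp [this] at h0

theorem deriv_zero_of_even {f : ℂ → ℂ} (hf : ∀ v, f (-v) = f v) : deriv f 0 = 0 := by
  have h := deriv_comp_neg (f := f) 0
  simp only [hf, neg_zero] at h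
  linear_combination h / 2

/-- `2 sinh (v / 2) / v`, continued to the origin. -/
noncomputable def sinhQuot : ℂ → ℂ := dslope (fun v => 2 * Complex.sinh (v / 2)) 0

theorem hasDerivAt_two_mul_sinh_half (v : ℂ) :
    HasDerivAt (fun v => 2 * Complex.sinh (v / 2)) (Complex.cosh (v / 2)) v := by
  have := (((hasDerivAt_id v).div_const 2).csinh).const_mul 2
  convert! this using 1
  simp; ring

theorem mul_sinhQuot (v : ℂ) : v * sinhQuot v = 2 * Complex.sinh (v / 2) := by
  have := sub_smul_dslope (fun v => 2 * Complex.sinh (v / 2)) 0 v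
  simpa [sinhQuot] using this

theorem sinhQuot_zero : sinhQuot 0 = 1 := by
  rw [sinhQuot, dslope_same, (hasDerivAt_two_mul_sinh_half 0).deriv]; simp

theorem differentiable_sinhQuot : Differentiable ℂ sinhQuot := by
  rw [← differentiableOn_univ, sinhQuot, Complex.differentiableOn_dslope univ_mem]
  exact fun v _ => (hasDerivAt_two_mul_sinh_half v).differentiableAt.differentiableWithinAt

/-- Evenness removes the linear Taylor coefficient, so the residue of the kernel at the origin is
exactly `β`. -/
theorem sinhQuot_neg (v : ℂ) : sinhQuot (-v) = sinhQuot v := by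
  by_cases h : v = 0
  · simp [h]
  · apply mul_left_cancel₀ h
    have := mul_sinhQuot (-v)
    rw [neg_div, Complex.sinh_neg] at this
    rw [mul_sinhQuot]
    linear_combination -this

theorem exp_mul_sinhQuot_sq (v : ℂ) :
    Complex.exp v * (v * sinhQuot v) ^ 2 = (1 - Complex.exp v) ^ 2 := by
  rw [mul_sinhQuot, Complex.sinh]
  have h1 : Complex.exp v = Complex.exp (v / 2) ^ 2 := by
    rw [← Complex.exp_nat_mul]; congr 1; push_cast; ring
  have h2 : Complex.exp (-(v / 2)) * Complex.exp (v / 2) = 1 := by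
    rw [← Complex.exp_add]; simp
  rw [h1]
  linear_combination (Complex.exp (v / 2) ^ 2 * (-2)
    + Complex.exp (-(v / 2)) * Complex.exp (v / 2) + 1) * h2

theorem sinhQuot_ne_zero {a : ℝ} {v : ℂ} (hv : v ∈ slantedStrip a) : sinhQuot v ≠ 0 := by
  by_cases h : v = 0
  · simp [h, sinhQuot_zero]
  · intro h0
    have := exp_mul_sinhQuot_sq v
    rw [h0] at this
    have h1 : 1 - Complex.exp v = 0 := by simpa using this.symm
    exact exp_ne_one_of_mem_slantedStrip hv h (sub_eq_zero.1 h1).symm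

/-- The kernel is `v⁻² + β v⁻¹` plus a holomorphic function in the strip. -/
theorem exists_kernel_eq (a : ℝ) (β : ℂ) : ∃ E : ℂ → ℂ, DifferentiableOn ℂ E (slantedStrip a) ∧
    ∀ v ∈ slantedStrip a, v ≠ 0 → kernel β v = 1 / v ^ 2 + β / v + E v := by
  set n : ℂ → ℂ := fun v => Complex.exp (β * v) / sinhQuot v ^ 2 with hn
  have hU : slantedStrip a ∈ 𝓝 (0 : ℂ) :=
    (isOpen_slantedStrip a).mem_nhds (zero_mem_slantedStrip a)
  have hnd : DifferentiableOn ℂ n (slantedStrip a) := fun v hv => by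
    have he : DifferentiableAt ℂ (fun v => Complex.exp (β * v)) v := by fun_prop
    exact (he.div ((differentiable_sinhQuot v).pow 2)
      (pow_ne_zero 2 (sinhQuot_ne_zero hv))).differentiableWithinAt
  have hn0 : n 0 = 1 := by simp [hn, sinhQuot_zero]
  have hn1 : deriv n 0 = β := by
    have hs : HasDerivAt sinhQuot 0 0 := by
      have := (differentiable_sinhQuot 0).hasDerivAt
      rwa [deriv_zero_of_even sinhQuot_neg] at this
    have he : HasDerivAt (fun v => Complex.exp (β * v)) (Complex.exp (β * 0) * (β * 1)) 0 :=
      ((hasDerivAt_id (0 : ℂ)).const_mul β).cexp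
    have := he.div (hs.pow 2) (by simp [sinhQuot_zero])
    rw [show n = (fun v => Complex.exp (β * v)) / (sinhQuot ^ 2) from rfl, this.deriv]
    simp [sinhQuot_zero]
  -- Since `kernel β v = n v / v²` and `n v = 1 + β v + O(v²)`, the holomorphic remainder is the
  -- second divided difference of `n`.
  refine ⟨dslope (dslope n 0) 0, ?_, fun v hv h0 => ?_⟩
  · rw [Complex.differentiableOn_dslope hU, Complex.differentiableOn_dslope hU]
    exact hnd
  · have e1 := sub_smul_dslope n 0 v
    have e2 := sub_smul_dslope (dslope n 0) 0 v
    rw [dslope_same, hn1] at e2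
    rw [hn0] at e1
    simp only [sub_zero, smul_eq_mul] at e1 e2
    have hk : kernel β v = n v / v ^ 2 := by
      have h1 := exp_mul_sinhQuot_sq v
      have h2 := sinhQuot_ne_zero hv
      have h3 := Complex.exp_ne_zero v
      rw [kernel, ← h1, add_mul, one_mul, Complex.exp_add, hn]
      field_simp
    rw [hk]
    field_simp
    linear_combination -e1 - v * e2

/-! ### Finite parts of the kernel along parallel lines -/

/-- A quarter turn of the right half-plane does not cross the branch cut. This compares the
different logarithms used as primitives of `1 / v`. -/
theorem log_neg_mul_I_mul {v : ℂ} (hv : 0 < v.re) {s : ℝ} (hs : s = 1 ∨ s = -1) :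
    Complex.log (-(s * Complex.I * v)) = Complex.log v - s * (Complex.I * Real.pi / 2) := by
  have hv0 : v ≠ 0 := by rintro rfl; simp at hv
  have harg := abs_lt.1 (Complex.abs_arg_lt_pi_div_two_iff.2 (Or.inl hv))
  have him : (Complex.log v - s * (Complex.I * Real.pi / 2)).im = v.arg - s * (Real.pi / 2) := by
    rw [show (s : ℂ) * (Complex.I * Real.pi / 2) = (s * (Real.pi / 2) : ℝ) * Complex.I by
      push_cast; ring]
    rw [Complex.sub_im, Complex.log_im, Complex.mul_I_im, Complex.ofReal_re]
  have hexp : Complex.exp (Complex.log v - s * (Complex.I * Real.pi / 2))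
      = -(s * Complex.I * v) := by
    rw [Complex.exp_sub, Complex.exp_log hv0]
    have : Complex.exp (s * (Complex.I * Real.pi / 2)) = s * Complex.I := by
      rcases hs with rfl | rfl
      · rw [show ((1 : ℝ) : ℂ) * (Complex.I * Real.pi / 2) = Real.pi / 2 * Complex.I by
          push_cast; ring, Complex.exp_pi_div_two_mul_I]
        simp
      · rw [show ((-1 : ℝ) : ℂ) * (Complex.I * Real.pi / 2) = -(Real.pi / 2 * Complex.I) by
          push_cast; ring, Complex.exp_neg, Complex.exp_pi_div_two_mul_I]
        simp
    rw [this]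
    have hs2 : (s : ℂ) ^ 2 = 1 := by rcases hs with rfl | rfl <;> norm_num
    have hs0 : (s : ℂ) ≠ 0 := by rintro h; simp [h] at hs2
    field_simp
    rw [Complex.I_sq, hs2]; ring
  rw [← hexp, Complex.log_exp]
  · rw [him]; rcases hs with rfl | rfl <;> linarith [Real.pi_pos, harg.1, harg.2]
  · rw [him]; rcases hs with rfl | rfl <;> linarith [Real.pi_pos, harg.1, harg.2]

theorem line_re (a σ δ : ℝ) : ((a + Complex.I) * σ + Complex.I * δ).re = a * σ := by simp

theorem line_im (a σ δ : ℝ) : ((a + Complex.I) * σ + Complex.I * δ).im = σ + δ := by simp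

theorem line_mem_slantedStrip {a : ℝ} (ha : 0 < a) (σ : ℝ) {δ : ℝ} (hδ : |δ| < 2 * Real.pi) :
    (a + Complex.I) * σ + Complex.I * δ ∈ slantedStrip a := by
  simp only [slantedStrip, Set.mem_ofPred_eq, line_re, line_im]
  rw [mul_div_cancel_left₀ _ ha.ne']
  simpa using hδ

theorem hasDerivAt_line (a σ δ : ℝ) :
    HasDerivAt (fun σ : ℝ => (a + Complex.I) * σ + Complex.I * δ) (a + Complex.I) σ := by
  simpa using ((Complex.ofRealCLM.hasDerivAt (x := σ)).const_mul (a + Complex.I)).add_const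
    (Complex.I * δ)

theorem continuousOn_kernel_line {a : ℝ} (ha : 0 < a) (β : ℂ) {δ : ℝ} (hδ : |δ| < 2 * Real.pi) :
    ContinuousOn (fun σ : ℝ => kernel β ((a + Complex.I) * σ + Complex.I * δ)) {0}ᶜ := by
  unfold kernel
  refine ContinuousOn.div (by fun_prop) (by fun_prop) fun σ hσ => ?_
  have h0 : (a + Complex.I) * σ + Complex.I * δ ≠ 0 := fun h => by
    have := line_re a σ δ
    rw [h] at this
    have : σ = 0 := by simpa [ha.ne'] using this.symm
    exact hσ this
  exact pow_ne_zero 2 (sub_ne_zero.2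
    (exp_ne_one_of_mem_slantedStrip (line_mem_slantedStrip ha σ hδ) h0).symm)

theorem hasDerivAt_neg_inv {v : ℂ} (hv : v ≠ 0) :
    HasDerivAt (fun v : ℂ => -v⁻¹) (1 / v ^ 2) v := by
  convert! (hasDerivAt_inv hv).neg using 1
  field_simp

/-- Finite parts of the kernel along the lines `(a + i) σ + i δ`, in terms of primitives in the
two halves of the strip. -/
theorem exists_primitives {a : ℝ} (ha : 0 < a) (β : ℂ) : ∃ Φ Ψ : ℂ → ℂ,
    (∀ v ∈ slantedStrip a, v.re < 0 → HasDerivAt Φ (kernel β v) v) ∧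
    (∀ v ∈ slantedStrip a, 0 < v.re → HasDerivAt Ψ (kernel β v) v) ∧
    ∀ δ : ℝ, |δ| < 2 * Real.pi → ∀ A b : ℝ, A < 0 → 0 < b →
      HasFinitePart
        (fun σ => (a + Complex.I) * kernel β ((a + Complex.I) * σ + Complex.I * δ)) 0 A b
        (Ψ ((a + Complex.I) * b + Complex.I * δ) - Φ ((a + Complex.I) * A + Complex.I * δ)
          - Complex.I * Real.pi * β * (SignType.sign δ : ℝ)) := by
  obtain ⟨E, hE, hk⟩ := exists_kernel_eq a β
  obtain ⟨P, hP'⟩ := (convex_slantedStrip a).exists_forall_hasDerivWithinAt hE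
  have hP : ∀ v ∈ slantedStrip a, HasDerivAt P (E v) v := fun v hv =>
    (hP' v hv).hasDerivAt ((isOpen_slantedStrip a).mem_nhds hv)
  have hprim : ∀ (c : ℂ) (v : ℂ), v ∈ slantedStrip a → c * v ∈ Complex.slitPlane →
      HasDerivAt (fun v => -v⁻¹ + β * Complex.log (c * v) + P v) (kernel β v) v := by
    intro c v hv hc
    have hcv : c * v ≠ 0 := Complex.slitPlane_ne_zero hc
    have hv0 : v ≠ 0 := right_ne_zero_of_mul hcv
    have hc0 : c ≠ 0 := left_ne_zero_of_mul hcv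
    rw [hk v hv hv0]
    convert! ((hasDerivAt_neg_inv hv0).add
      ((((hasDerivAt_id v).const_mul c).clog hc).const_mul β)).add (hP v hv) using 2
    simp only [id]
    field_simp
  -- Each logarithm has its cut in the half-plane opposite to the one where the primitive is used.
  set Φ : ℂ → ℂ := fun v => -v⁻¹ + β * Complex.log (-1 * v) + P v with hΦ
  set Ψ : ℂ → ℂ := fun v => -v⁻¹ + β * Complex.log (1 * v) + P v with hΨ
  have hΦd : ∀ v ∈ slantedStrip a, v.re < 0 → HasDerivAt Φ (kernel β v) v := fun v hv h =>
    hprim (-1) v hv (Or.inl (by simpa using h))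
  have hΨd : ∀ v ∈ slantedStrip a, 0 < v.re → HasDerivAt Ψ (kernel β v) v := fun v hv h =>
    hprim 1 v hv (Or.inl (by simpa using h))
  refine ⟨Φ, Ψ, hΦd, hΨd, fun δ hδ A b hA hb => ?_⟩
  have hF : ContinuousOn
      (fun σ : ℝ => (a + Complex.I) * kernel β ((a + Complex.I) * σ + Complex.I * δ)) {0}ᶜ :=
    (continuousOn_kernel_line ha β hδ).const_smul (a + Complex.I)
  have hcomp : ∀ {f : ℂ → ℂ} {σ : ℝ},
      HasDerivAt f (kernel β ((a + Complex.I) * σ + Complex.I * δ))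
        ((a + Complex.I) * σ + Complex.I * δ) →
      HasDerivAt (fun σ : ℝ => f ((a + Complex.I) * σ + Complex.I * δ))
        ((a + Complex.I) * kernel β ((a + Complex.I) * σ + Complex.I * δ)) σ := by
    intro f σ hf
    exact (hf.comp σ (hasDerivAt_line a σ δ)).congr_deriv (mul_comm _ _)
  rcases eq_or_ne δ 0 with rfl | hδ0
  · have hmem : ∀ σ : ℝ, (a + Complex.I) * σ ∈ slantedStrip a := fun σ => by
      simpa using line_mem_slantedStrip ha σ hδ
    convert! hasFinitePart_of_hasDerivAt (c := 0) hA hb hF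
      (fun t ht => hcomp (hΦd _ (line_mem_slantedStrip ha t hδ)
        (by rw [line_re]; exact mul_neg_of_pos_of_neg ha ht)))
      (fun t ht => hcomp (hΨd _ (line_mem_slantedStrip ha t hδ)
        (by rw [line_re]; exact mul_pos ha ht))) ?_ using 1
    · simp
    · have hPc : Continuous fun ε : ℝ => P ((a + Complex.I) * ε) :=
        continuous_iff_continuousAt.2 fun ε =>
          ContinuousAt.comp (f := fun ε : ℝ => (a + Complex.I) * (ε : ℂ))
            (hP _ (hmem ε)).continuousAt (by fun_prop)
      have hEc : Continuous fun ε : ℝ => E ((a + Complex.I) * ε) :=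
        continuous_iff_continuousAt.2 fun ε =>
          ContinuousAt.comp (f := fun ε : ℝ => (a + Complex.I) * (ε : ℂ))
            (hE.continuousOn.continuousAt ((isOpen_slantedStrip a).mem_nhds (hmem ε)))
            (by fun_prop)
      -- With `p = a + i`, the terms `2 / (pε)` from the primitives and from the Hadamard correction
      -- cancel, as do the logarithms and the odd terms `β / v`. Only this continuous function,
      -- vanishing at `0`, is left.
      have hcont : Continuous fun ε : ℝ => P ((a + Complex.I) * (-ε : ℝ))
          - P ((a + Complex.I) * ε) - ε * (a + Complex.I) * (E ((a + Complex.I) * ε)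
            + E ((a + Complex.I) * (-ε : ℝ))) := by
        have h1 := hPc.comp (continuous_neg (G := ℝ))
        have h2 := hEc.comp (continuous_neg (G := ℝ))
        have h3 : Continuous fun ε : ℝ => (ε : ℂ) * (a + Complex.I) := by fun_prop
        exact (h1.sub hPc).sub (h3.mul (hEc.add h2))
      have hlim := (hcont.tendsto 0).mono_left (nhdsWithin_le_nhds (s := Set.Ioi 0))
      simp only [neg_zero, Complex.ofReal_zero, mul_zero, sub_self, zero_mul] at hlim
      refine hlim.congr' ?_
      filter_upwards [self_mem_nhdsWithin] with ε hε
      have hε : 0 < ε := hε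
      have hpne : (a + Complex.I) ≠ 0 := fun h => by
        have := congrArg Complex.im h
        simp at this
      have hεne : (ε : ℂ) ≠ 0 := by exact_mod_cast hε.ne'
      simp only [zero_sub, zero_add, Complex.ofReal_zero, mul_zero, add_zero]
      rw [hk _ (hmem ε) (mul_ne_zero hpne hεne),
        hk _ (hmem (-ε)) (mul_ne_zero hpne (by simpa using hεne))]
      simp only [hΦ, hΨ, Complex.ofReal_neg]
      rw [show -1 * ((a + Complex.I) * -(ε : ℂ)) = 1 * ((a + Complex.I) * ε) by ring]
      field_simp
      ring
  · set s : ℝ := (SignType.sign δ : ℝ) with hs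
    have hs1 : s = 1 ∨ s = -1 := by
      rcases lt_or_gt_of_ne hδ0 with h | h
      · right; simp [hs, h]
      · left; simp [hs, h]
    have hsδ : 0 < s * δ := by rw [hs, sign_mul_self]; exact abs_pos.2 hδ0
    have hs0 : s ≠ 0 := left_ne_zero_of_mul hsδ.ne'
    -- The cut of this logarithm is the ray from the origin in direction `-s i`. The line crosses
    -- the imaginary axis at `i δ`, on the other side, so `Θ` is a primitive along all of it.
    set Θ : ℂ → ℂ := fun v => -v⁻¹ + β * Complex.log (-(s * Complex.I) * v) + P v with hΘ
    have hΘd : ∀ σ : ℝ, HasDerivAt (fun σ : ℝ => Θ ((a + Complex.I) * σ + Complex.I * δ))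
        ((a + Complex.I) * kernel β ((a + Complex.I) * σ + Complex.I * δ)) σ := fun σ => by
      refine hcomp (hprim _ _ (line_mem_slantedStrip ha σ hδ) ?_)
      have e : -(s * Complex.I) * ((a + Complex.I) * σ + Complex.I * δ)
          = ((s * (σ + δ) : ℝ) : ℂ) + ((-(s * a * σ) : ℝ) : ℂ) * Complex.I := by
        push_cast
        linear_combination (-(s : ℂ) * (σ + δ)) * Complex.I_sq
      rw [e, Complex.mem_slitPlane_iff]
      rcases eq_or_ne σ 0 with rfl | hσ
      · left; simpa using hsδ
      · right; simp [hs0, ha.ne', hσ]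
    have hne : ∀ σ : ℝ, (a + Complex.I) * σ + Complex.I * δ ≠ 0 := fun σ h => by
      have h1 := line_re a σ δ
      have h2 := line_im a σ δ
      rw [h] at h1 h2
      have h3 : σ = 0 := by simpa [ha.ne'] using h1.symm
      simp [h3] at h2
      exact hδ0 h2.symm
    have hFc : Continuous
        (fun σ : ℝ => (a + Complex.I) * kernel β ((a + Complex.I) * σ + Complex.I * δ)) := by
      unfold kernel
      refine continuous_const.mul (Continuous.div (by fun_prop) (by fun_prop) fun σ => ?_)
      exact pow_ne_zero 2 (sub_ne_zero.2
        (exp_ne_one_of_mem_slantedStrip (line_mem_slantedStrip ha σ hδ) (hne σ)).symm)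
    convert! hasFinitePart_of_hasDerivAt (c := 0) hA hb hF (fun t _ => hΘd t) (fun t _ => hΘd t)
      ?_ using 1
    -- `Θ` differs from `Ψ` by `-s iπβ/2` on the right and from `Φ` by `+s iπβ/2` on the left;
    -- together these give the jump `-iπβ s`.
    · have hr := log_neg_mul_I_mul (v := (a + Complex.I) * b + Complex.I * δ)
        (by rw [line_re]; positivity) hs1
      have hl := log_neg_mul_I_mul (v := -((a + Complex.I) * A + Complex.I * δ))
        (by rw [Complex.neg_re, line_re]; nlinarith) (s := -s) (by
          rcases hs1 with h | h <;> simp [h])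
      simp only [hΦ, hΨ, hΘ, neg_mul, one_mul]
      rw [hr]
      rw [Complex.ofReal_neg, show -(-(s : ℂ) * Complex.I * -((a + Complex.I) * A + Complex.I * δ))
        = -(s * Complex.I * ((a + Complex.I) * A + Complex.I * δ)) by ring] at hl
      rw [hl]
      ring
    · have hΘc : Continuous (fun σ : ℝ => Θ ((a + Complex.I) * σ + Complex.I * δ)) :=
        continuous_iff_continuousAt.2 fun σ => (hΘd σ).continuousAt
      have hcont := ((hΘc.comp
        (continuous_const.sub continuous_id : Continuous fun ε : ℝ => 0 - ε)).sub
        (hΘc.comp (continuous_const.add continuous_id : Continuous fun ε : ℝ => 0 + ε))).sub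
        (Complex.continuous_ofReal.mul
          ((hFc.comp (continuous_const.add continuous_id : Continuous fun ε : ℝ => 0 + ε)).add
          (hFc.comp (continuous_const.sub continuous_id : Continuous fun ε : ℝ => 0 - ε))))
      have hlim := (hcont.tendsto 0).mono_left (nhdsWithin_le_nhds (s := Set.Ioi 0))
      refine (hlim.congr fun ε => rfl).trans_eq ?_
      simp

/-! ### Behaviour of the kernel at the ends of the strip -/

/-- Write `v = (a + i) (Re v / a) + i (Im v - Re v / a)`; the last bracket is below `2π` in modulus.
-/
theorem norm_exp_mul_le {a : ℝ} (ha : a ≠ 0) {γ v : ℂ} (hv : v ∈ slantedStrip a) :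
    ‖Complex.exp (γ * v)‖
      ≤ Real.exp ((γ * (a + Complex.I)).re * (v.re / a) + 2 * Real.pi * |γ.im|) := by
  rw [Complex.norm_exp, Real.exp_le_exp]
  have h : |v.im - v.re / a| < 2 * Real.pi := hv
  have e : (γ * v).re = (γ * (a + Complex.I)).re * (v.re / a) - γ.im * (v.im - v.re / a) := by
    simp; field_simp; ring
  have h1 : -(γ.im * (v.im - v.re / a)) ≤ |γ.im| * |v.im - v.re / a| := by
    rw [← abs_mul]; exact neg_le_abs _
  nlinarith [abs_nonneg γ.im]

theorem norm_kernel_le {a : ℝ} (ha : 0 < a) {β v : ℂ} (hβ : (β * (a + Complex.I)).re = a)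
    (hv : v ∈ slantedStrip a) (hre : Real.exp v.re ≤ 1 / 2) :
    ‖kernel β v‖ ≤ 4 * Real.exp (2 * Real.pi * |β.im|) * Real.exp (2 * v.re) := by
  have h1 := norm_exp_mul_le ha.ne' (γ := β + 1) hv
  have e : ((β + 1) * (a + Complex.I)).re = 2 * a := by
    rw [add_mul, Complex.add_re, hβ]; simp; ring
  rw [e, show 2 * a * (v.re / a) = 2 * v.re by field_simp, Real.exp_add] at h1
  simp only [Complex.add_im, Complex.one_im, add_zero] at h1
  have h2 : 1 / 2 ≤ ‖1 - Complex.exp v‖ := by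
    have := norm_sub_norm_le 1 (Complex.exp v)
    rw [norm_one, Complex.norm_exp] at this
    linarith
  rw [kernel, norm_div, norm_pow, div_le_iff₀ (by positivity)]
  have h3 : (1 / 2 : ℝ) ^ 2 ≤ ‖1 - Complex.exp v‖ ^ 2 := by gcongr
  have h4 : 0 ≤ Real.exp (2 * v.re) * Real.exp (2 * Real.pi * |β.im|) := by positivity
  nlinarith

/-- With `z = e^{-v}` the kernel is `e^{(β-1)v} / (1 - z)²`, and `1 / (1 - z)² - 1 = z (2 - z) / (1
- z)²`. The exponential is bounded because `(β - 1)(a + i)` is purely imaginary; `10` is `(5/2) /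
(1/2)²`. -/
theorem norm_kernel_sub_exp_le {a : ℝ} (ha : 0 < a) {β v : ℂ}
    (hβ : (β * (a + Complex.I)).re = a) (hv : v ∈ slantedStrip a)
    (hre : Real.exp (-v.re) ≤ 1 / 2) :
    ‖kernel β v - Complex.exp ((β - 1) * v)‖
      ≤ 10 * Real.exp (2 * Real.pi * |β.im|) * Real.exp (-v.re) := by
  have h1 := norm_exp_mul_le ha.ne' (γ := β - 1) hv
  have e : ((β - 1) * (a + Complex.I)).re = 0 := by
    rw [sub_mul, Complex.sub_re, hβ]; simp
  rw [e] at h1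
  simp only [Complex.sub_im, Complex.one_im, sub_zero, zero_mul, zero_add] at h1
  set z := Complex.exp (-v) with hz
  have hzn : ‖z‖ = Real.exp (-v.re) := by rw [hz, Complex.norm_exp, Complex.neg_re]
  rw [← hzn] at hre ⊢
  have h2 : 1 / 2 ≤ ‖1 - z‖ := by
    have := norm_sub_norm_le 1 z
    rw [norm_one] at this
    linarith
  have hne : 1 - z ≠ 0 := norm_pos_iff.1 (by linarith)
  have hz0 : z ≠ 0 := Complex.exp_ne_zero _
  have hv1 : Complex.exp v = z⁻¹ := by rw [hz, Complex.exp_neg, inv_inv]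
  have hne' : z - 1 ≠ 0 := fun h => hne (by linear_combination -h)
  have e2 : kernel β v - Complex.exp ((β - 1) * v)
      = Complex.exp ((β - 1) * v) * (z * (2 - z) / (1 - z) ^ 2) := by
    rw [kernel, show (β + 1) * v = (β - 1) * v + v + v by ring, Complex.exp_add, Complex.exp_add,
      hv1]
    have h5 : 1 - z⁻¹ = (z - 1) / z := by field_simp
    rw [h5]
    field_simp
    ring
  have h3 : ‖z * (2 - z) / (1 - z) ^ 2‖ ≤ 10 * ‖z‖ := by
    rw [norm_div, norm_mul, norm_pow, div_le_iff₀ (by positivity)]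
    have h6 : ‖2 - z‖ ≤ 5 / 2 := by
      refine (norm_sub_le _ _).trans ?_
      rw [Complex.norm_ofNat]; linarith
    have h7 : (1 / 2 : ℝ) ^ 2 ≤ ‖1 - z‖ ^ 2 := by gcongr
    nlinarith [norm_nonneg z, mul_le_mul_of_nonneg_left h6 (norm_nonneg z),
      mul_le_mul_of_nonneg_left h7 (norm_nonneg z)]
  rw [e2, norm_mul]
  calc _ ≤ Real.exp (2 * Real.pi * |β.im|) * (10 * ‖z‖) := by gcongr
    _ = _ := by ring

/-! ### Values of the finite parts along the parallel lines -/

/-- The two points are at distance `|δ|` in a convex region where the derivative is exponentially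
small. Hence the contribution of this end does not depend on the line. -/
theorem tendsto_primitive_left {a : ℝ} (ha : 0 < a) {β : ℂ}
    (hβ : (β * (a + Complex.I)).re = a) {Φ : ℂ → ℂ}
    (hΦ : ∀ v ∈ slantedStrip a, v.re < 0 → HasDerivAt Φ (kernel β v) v)
    {δ : ℝ} (hδ : |δ| < 2 * Real.pi) :
    Tendsto (fun A : ℝ => Φ ((a + Complex.I) * A + Complex.I * δ)
      - Φ ((a + Complex.I) * A)) atBot (𝓝 0) := by
  have hlim0 : Tendsto (fun A : ℝ => Real.exp (a * A)) atBot (𝓝 0) :=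
    Real.tendsto_exp_atBot.comp (tendsto_id.const_mul_atBot ha)
  have hlim : Tendsto (fun A : ℝ => 4 * Real.exp (2 * Real.pi * |β.im|)
      * Real.exp (2 * (a * A)) * ‖Complex.I * δ‖) atBot (𝓝 0) := by
    have : Tendsto (fun A : ℝ => Real.exp (2 * (a * A))) atBot (𝓝 0) :=
      Real.tendsto_exp_atBot.comp ((tendsto_id.const_mul_atBot ha).const_mul_atBot two_pos)
    simpa using (this.const_mul (4 * Real.exp (2 * Real.pi * |β.im|))).mul_const ‖Complex.I * δ‖
  refine squeeze_zero_norm' ?_ hlim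
  filter_upwards [hlim0.eventually_le_const (by norm_num : (0 : ℝ) < 1 / 2), Iio_mem_atBot 0]
    with A hA hA0
  have hA0 : A < 0 := hA0
  have haA : a * A < 0 := mul_neg_of_pos_of_neg ha hA0
  have hs : Convex ℝ (slantedStrip a ∩ {v | v.re ≤ a * A}) :=
    (convex_slantedStrip a).inter (convex_halfSpace_re_le _)
  have hx : (a + Complex.I) * A ∈ slantedStrip a ∩ {v | v.re ≤ a * A} :=
    ⟨by simpa using line_mem_slantedStrip ha A (δ := 0) (by simp [Real.pi_pos]), by simp⟩
  have hy : (a + Complex.I) * A + Complex.I * δ ∈ slantedStrip a ∩ {v | v.re ≤ a * A} :=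
    ⟨line_mem_slantedStrip ha A hδ, by simp⟩
  have := hs.norm_image_sub_le_of_norm_hasDerivWithin_le (f := Φ) (f' := kernel β)
    (C := 4 * Real.exp (2 * Real.pi * |β.im|) * Real.exp (2 * (a * A)))
    (fun v hv => (hΦ v hv.1 (lt_of_le_of_lt hv.2 haA)).hasDerivWithinAt)
    (fun v hv => by
      have hv2 : v.re ≤ a * A := hv.2
      refine (norm_kernel_le ha hβ hv.1 ((Real.exp_le_exp.2 hv2).trans hA)).trans ?_
      gcongr) hx hy
  simpa using this

theorem tendsto_primitive_right {a : ℝ} (ha : 0 < a) {β : ℂ}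
    (hβ : (β * (a + Complex.I)).re = a) (hβ1 : β ≠ 1) {Ψ : ℂ → ℂ}
    (hΨ : ∀ v ∈ slantedStrip a, 0 < v.re → HasDerivAt Ψ (kernel β v) v)
    {δ : ℝ} (hδ : |δ| < 2 * Real.pi) :
    Tendsto (fun b : ℝ =>
      (Ψ ((a + Complex.I) * b + Complex.I * δ)
        - Complex.exp ((β - 1) * ((a + Complex.I) * b + Complex.I * δ)) / (β - 1))
      - (Ψ ((a + Complex.I) * b) - Complex.exp ((β - 1) * ((a + Complex.I) * b)) / (β - 1)))
      atTop (𝓝 0) := by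
  have hlim0 : Tendsto (fun b : ℝ => Real.exp (-(a * b))) atTop (𝓝 0) :=
    Real.tendsto_exp_neg_atTop_nhds_zero.comp (tendsto_id.const_mul_atTop ha)
  have hlim : Tendsto (fun b : ℝ => 10 * Real.exp (2 * Real.pi * |β.im|)
      * Real.exp (-(a * b)) * ‖Complex.I * δ‖) atTop (𝓝 0) := by
    simpa using (hlim0.const_mul (10 * Real.exp (2 * Real.pi * |β.im|))).mul_const ‖Complex.I * δ‖
  refine squeeze_zero_norm' ?_ hlim
  filter_upwards [hlim0.eventually_le_const (by norm_num : (0 : ℝ) < 1 / 2), Ioi_mem_atTop 0]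
    with b hb hb0
  have hb0 : 0 < b := hb0
  have hab : 0 < a * b := mul_pos ha hb0
  have hs : Convex ℝ (slantedStrip a ∩ {v | a * b ≤ v.re}) :=
    (convex_slantedStrip a).inter (convex_halfSpace_re_ge _)
  have hx : (a + Complex.I) * b ∈ slantedStrip a ∩ {v | a * b ≤ v.re} :=
    ⟨by simpa using line_mem_slantedStrip ha b (δ := 0) (by simp [Real.pi_pos]), by simp⟩
  have hy : (a + Complex.I) * b + Complex.I * δ ∈ slantedStrip a ∩ {v | a * b ≤ v.re} :=
    ⟨line_mem_slantedStrip ha b hδ, by simp⟩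
  have hβ1' : β - 1 ≠ 0 := sub_ne_zero.2 hβ1
  have := hs.norm_image_sub_le_of_norm_hasDerivWithin_le
    (f := fun v => Ψ v - Complex.exp ((β - 1) * v) / (β - 1))
    (f' := fun v => kernel β v - Complex.exp ((β - 1) * v))
    (C := 10 * Real.exp (2 * Real.pi * |β.im|) * Real.exp (-(a * b)))
    (fun v hv => by
      have h1 := ((((hasDerivAt_id v).const_mul (β - 1)).cexp).div_const (β - 1))
      have h2 := (hΨ v hv.1 (lt_of_lt_of_le hab hv.2)).sub h1
      refine HasDerivAt.hasDerivWithinAt (h2.congr_deriv ?_)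
      simp only [id, mul_one]
      rw [mul_div_cancel_right₀ _ hβ1'])
    (fun v hv => by
      have hv2 : -v.re ≤ -(a * b) := neg_le_neg hv.2
      refine (norm_kernel_sub_exp_le ha hβ hv.1 ((Real.exp_le_exp.2 hv2).trans hb)).trans ?_
      gcongr) hx hy
  simpa using this

/-- The finite parts of the kernel along the lines `(a + i) σ + i δ`, with the oscillating
contribution of the upper end split off. -/
theorem exists_hasFinitePart_kernel {a : ℝ} (ha : 0 < a) {β : ℂ}
    (hβ : (β * (a + Complex.I)).re = a) (hβ1 : β ≠ 1)
    (hq : Complex.exp (2 * Real.pi * Complex.I * β) ≠ 1) :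
    ∃ V : ℝ → ℝ → ℝ → ℂ,
      (∀ δ : ℝ, |δ| < 2 * Real.pi → ∀ A b : ℝ, A < 0 → 0 < b →
        HasFinitePart
          (fun σ => (a + Complex.I) * kernel β ((a + Complex.I) * σ + Complex.I * δ)) 0 A b
          (V δ A b)) ∧
      ∀ δ : ℝ, |δ| < 2 * Real.pi →
        Tendsto (fun x : ℝ × ℝ => V δ x.1 x.2
          - Complex.exp ((β - 1) * ((a + Complex.I) * x.2 + Complex.I * δ)) / (β - 1))
          (atBot ×ˢ atTop)
          (𝓝 (Complex.I * Real.pi * β * ((1 + Complex.exp (2 * Real.pi * Complex.I * β))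
            / (1 - Complex.exp (2 * Real.pi * Complex.I * β)) - (SignType.sign δ : ℝ)))) := by
  obtain ⟨Φ, Ψ, hΦ, hΨ, hV⟩ := exists_primitives ha β
  set q := Complex.exp (2 * Real.pi * Complex.I * β) with hqdef
  set V : ℝ → ℝ → ℝ → ℂ := fun δ A b =>
    Ψ ((a + Complex.I) * b + Complex.I * δ) - Φ ((a + Complex.I) * A + Complex.I * δ)
      - Complex.I * Real.pi * β * (SignType.sign δ : ℝ) with hVdef
  set e : ℝ → ℝ → ℂ := fun δ b =>
    Complex.exp ((β - 1) * ((a + Complex.I) * b + Complex.I * δ)) / (β - 1) with hedef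
  -- `D` is the central-line value without its oscillation. By `hdiff`, every other line differs
  -- from it in the limit only by its half-residue jump.
  set D : ℝ × ℝ → ℂ := fun x => Ψ ((a + Complex.I) * x.2) - e 0 x.2 - Φ ((a + Complex.I) * x.1)
    with hD
  have hdiff : ∀ δ : ℝ, |δ| < 2 * Real.pi →
      Tendsto (fun x : ℝ × ℝ => V δ x.1 x.2 - e δ x.2 - D x) (atBot ×ˢ atTop)
        (𝓝 (-(Complex.I * Real.pi * β * (SignType.sign δ : ℝ)))) := by
    intro δ hδ
    have h1 := (tendsto_primitive_left ha hβ hΦ hδ).comp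
      (tendsto_fst : Tendsto Prod.fst (atBot ×ˢ (atTop : Filter ℝ)) atBot)
    have h2 := (tendsto_primitive_right ha hβ hβ1 hΨ hδ).comp
      (tendsto_snd : Tendsto Prod.snd ((atBot : Filter ℝ) ×ˢ atTop) atTop)
    have h3 := (h2.sub h1).sub_const (Complex.I * Real.pi * β * (SignType.sign δ : ℝ))
    rw [sub_zero, zero_sub] at h3
    refine h3.congr fun x => ?_
    simp only [hVdef, hedef, hD, Function.comp_apply, Complex.ofReal_zero, mul_zero, add_zero]
    ring
  have hpi : |Real.pi| < 2 * Real.pi := by rw [abs_of_pos Real.pi_pos]; linarith [Real.pi_pos]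
  have hpi' : |-Real.pi| < 2 * Real.pi := by rwa [abs_neg]
  have hI : Complex.exp (2 * Real.pi * Complex.I) = 1 := Complex.exp_two_pi_mul_I
  have hker : ∀ v, kernel β (v + 2 * Real.pi * Complex.I) = q * kernel β v := fun v => by
    rw [kernel, kernel, Complex.exp_add v, hI, mul_one,
      show (β + 1) * (v + 2 * Real.pi * Complex.I)
        = (β + 1) * v + 2 * Real.pi * Complex.I * β + 2 * Real.pi * Complex.I by ring,
      Complex.exp_add, Complex.exp_add, hI]
    ring
  have hline : ∀ σ : ℝ, (a + Complex.I) * σ + Complex.I * Real.pi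
      = (a + Complex.I) * σ + Complex.I * (-Real.pi : ℝ) + 2 * Real.pi * Complex.I := fun σ => by
    push_cast; ring
  have hVq : ∀ A b : ℝ, A < 0 → 0 < b → V Real.pi A b = q * V (-Real.pi) A b := by
    intro A b hA hb
    have h1 := hV Real.pi hpi A b hA hb
    have h2 := (hV (-Real.pi) hpi' A b hA hb).const_mul q
    refine h1.unique ?_
    convert! h2 using 2 with σ
    rw [hline, hker]; ring
  have heq : ∀ b : ℝ, e Real.pi b = q * e (-Real.pi) b := fun b => by
    simp only [hedef]
    rw [hline, show (β - 1) * ((a + Complex.I) * b + Complex.I * (-Real.pi : ℝ)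
        + 2 * Real.pi * Complex.I)
      = (β - 1) * ((a + Complex.I) * b + Complex.I * (-Real.pi : ℝ))
        + 2 * Real.pi * Complex.I * β - 2 * Real.pi * Complex.I by ring,
      Complex.exp_sub, Complex.exp_add, hI]
    ring
  have hq1 : 1 - q ≠ 0 := sub_ne_zero.2 hq.symm
  have hDlim : Tendsto D (atBot ×ˢ atTop)
      (𝓝 (Complex.I * Real.pi * β * ((1 + q) / (1 - q)))) := by
    -- By quasi-periodicity the `V` and `e` terms cancel in this combination, leaving `(1 - q) D`.
    have h := ((hdiff (-Real.pi) hpi').const_mul q).sub (hdiff Real.pi hpi)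
    have h := h.div_const (1 - q)
    have hs : (SignType.sign (-Real.pi) : ℝ) = -1 := by
      rw [Left.sign_neg, sign_pos Real.pi_pos]; simp
    rw [hs, sign_pos Real.pi_pos] at h
    have hval : (q * -(Complex.I * Real.pi * β * ((-1 : ℝ) : ℂ))
        - -(Complex.I * Real.pi * β * (((1 : SignType) : ℝ) : ℂ))) / (1 - q)
        = Complex.I * Real.pi * β * ((1 + q) / (1 - q)) := by
      push_cast
      rw [SignType.coe_one]
      push_cast
      ring
    rw [hval] at h
    refine h.congr' ?_
    filter_upwards [prod_mem_prod (Iio_mem_atBot 0) (Ioi_mem_atTop 0)] with x hx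
    rw [heq, hVq _ _ hx.1 hx.2]
    field_simp
    ring
  refine ⟨V, hV, fun δ hδ => ?_⟩
  have h := (hdiff δ hδ).add hDlim
  have hval : -(Complex.I * Real.pi * β * (SignType.sign δ : ℝ))
      + Complex.I * Real.pi * β * ((1 + q) / (1 - q))
      = Complex.I * Real.pi * β * ((1 + q) / (1 - q) - (SignType.sign δ : ℝ)) := by ring
  rw [hval] at h
  refine h.congr fun x => ?_
  simp only [hedef]
  ring

/-! ### Superposition of kernels and cancellation of the oscillation -/

theorem HasFinitePart.add {F G : ℝ → ℂ} {x a b : ℝ} {L L' : ℂ} (ha : a < x) (hb : x < b)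
    (hF : ContinuousOn F {x}ᶜ) (hG : ContinuousOn G {x}ᶜ) (h : HasFinitePart F x a b L)
    (h' : HasFinitePart G x a b L') : HasFinitePart (fun t => F t + G t) x a b (L + L') := by
  have := HasFinitePart.sum (Finset.univ : Finset Bool) (F := fun i => cond i F G)
    (L := fun i => cond i L L') ha hb (by rintro (_ | _) _ <;> assumption)
    (by rintro (_ | _) _ <;> assumption)
  simpa only [Fintype.sum_bool, cond_true, cond_false] using this

theorem HasFinitePartLine.add {F G : ℝ → ℂ} {x : ℝ} {L L' : ℂ} (hF : ContinuousOn F {x}ᶜ)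
    (hG : ContinuousOn G {x}ᶜ) (h : HasFinitePartLine F x L) (h' : HasFinitePartLine G x L') :
    HasFinitePartLine (fun t => F t + G t) x (L + L') := by
  obtain ⟨V, hV, hL⟩ := h
  obtain ⟨V', hV', hL'⟩ := h'
  exact ⟨fun a b => V a b + V' a b,
    fun a b ha hb => (hV a b ha hb).add ha hb hF hG (hV' a b ha hb), hL.add hL'⟩

theorem HasFinitePartLine.const_mul {F : ℝ → ℂ} {x : ℝ} {L : ℂ} (c : ℂ)
    (h : HasFinitePartLine F x L) : HasFinitePartLine (fun t => c * F t) x (c * L) := by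
  obtain ⟨V, hV, hL⟩ := h
  exact ⟨fun a b => c * V a b, fun a b ha hb => (hV a b ha hb).const_mul c, hL.const_mul c⟩

/-- A combination of kernels along parallel lines, whose coefficients cancel the oscillation at
the upper end. -/
noncomputable def kernelSum {ι : Type*} [Fintype ι] (a : ℝ) (β : ℂ) (c : ι → ℂ) (δ : ι → ℝ)
    (σ : ℝ) : ℂ :=
  ∑ k, c k * Complex.exp (-(Complex.I * β * δ k))
    * ((a + Complex.I) * kernel β ((a + Complex.I) * σ + Complex.I * δ k))

theorem continuousOn_kernelSum_term {a : ℝ} (ha : 0 < a) (β c : ℂ) {δ : ℝ}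
    (hδ : |δ| < 2 * Real.pi) : ContinuousOn (fun σ : ℝ => c
      * ((a + Complex.I) * kernel β ((a + Complex.I) * σ + Complex.I * δ))) {0}ᶜ :=
  ((continuousOn_kernel_line ha β hδ).const_smul (a + Complex.I)).const_smul c

theorem continuousOn_kernelSum {ι : Type*} [Fintype ι] {a : ℝ} (ha : 0 < a) (β : ℂ) (c : ι → ℂ)
    {δ : ι → ℝ} (hδ : ∀ k, |δ k| < 2 * Real.pi) : ContinuousOn (kernelSum a β c δ) {0}ᶜ :=
  continuousOn_finsetSum _ fun k _ => continuousOn_kernelSum_term ha β _ (hδ k)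

theorem hasFinitePartLine_kernelSum {ι : Type*} [Fintype ι] {a : ℝ} (ha : 0 < a) {β : ℂ}
    (hβ : (β * (a + Complex.I)).re = a) (hβ1 : β ≠ 1)
    (hq : Complex.exp (2 * Real.pi * Complex.I * β) ≠ 1) (c : ι → ℂ) {δ : ι → ℝ}
    (hδ : ∀ k, |δ k| < 2 * Real.pi) (hc : ∑ k, c k * Complex.exp (-(Complex.I * δ k)) = 0) :
    HasFinitePartLine (kernelSum a β c δ) 0
      (∑ k, c k * Complex.exp (-(Complex.I * β * δ k))
        * (Complex.I * Real.pi * β * ((1 + Complex.exp (2 * Real.pi * Complex.I * β))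
            / (1 - Complex.exp (2 * Real.pi * Complex.I * β))
              - (SignType.sign (δ k) : ℝ)))) := by
  obtain ⟨V, hV, hlim⟩ := exists_hasFinitePart_kernel ha hβ hβ1 hq
  refine ⟨fun A b => ∑ k, c k * Complex.exp (-(Complex.I * β * δ k)) * V (δ k) A b,
    fun A b hA hb => ?_, ?_⟩
  · exact HasFinitePart.sum _ hA hb
      (fun k _ => continuousOn_kernelSum_term ha β _ (hδ k))
      fun k _ => (hV (δ k) (hδ k) A b hA hb).const_mul _
  · refine (tendsto_finsetSum _ fun k _ => (hlim (δ k) (hδ k)).const_mul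
      (c k * Complex.exp (-(Complex.I * β * δ k)))).congr fun x => ?_
    -- The weight `e^{-iβδ}` turns the phase `e^{(β-1)iδ}` into `e^{-iδ}`, so the oscillations share
    -- a common factor and sum to zero by `hc`.
    have h0 : ∑ k, c k * Complex.exp (-(Complex.I * β * δ k))
        * (Complex.exp ((β - 1) * ((a + Complex.I) * x.2 + Complex.I * δ k)) / (β - 1)) = 0 := by
      have : ∀ k, c k * Complex.exp (-(Complex.I * β * δ k))
          * (Complex.exp ((β - 1) * ((a + Complex.I) * x.2 + Complex.I * δ k)) / (β - 1))
          = Complex.exp ((β - 1) * ((a + Complex.I) * x.2)) / (β - 1)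
            * (c k * Complex.exp (-(Complex.I * δ k))) := fun k => by
        rw [show (β - 1) * ((a + Complex.I) * x.2 + Complex.I * δ k)
          = (β - 1) * ((a + Complex.I) * x.2) + Complex.I * β * δ k + -(Complex.I * δ k) by ring,
          Complex.exp_add, Complex.exp_add, Complex.exp_neg (Complex.I * β * δ k)]
        field_simp
      simp only [this, ← Finset.mul_sum, hc, mul_zero]
    simp only [mul_sub, Finset.sum_sub_distrib, h0, sub_zero]

/-! ### Alexander spirals -/

theorem abs_angleDiff_lt {M : ℕ} (k m : Fin M) : |angleDiff M k m| < 2 * Real.pi := by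
  have hM : (0 : ℝ) < M := by exact_mod_cast k.pos
  have hk : (k : ℝ) < M := by exact_mod_cast k.2
  have hm : (m : ℝ) < M := by exact_mod_cast m.2
  have hk0 : (0 : ℝ) ≤ k := by positivity
  have hm0 : (0 : ℝ) ≤ m := by positivity
  have e : angleDiff M k m = 2 * Real.pi * (((k : ℝ) - m) / M) := by
    unfold angleDiff angle; ring
  have h1 : |((k : ℝ) - m) / M| < 1 := by
    rw [abs_div, abs_of_pos hM, div_lt_one hM, abs_lt]
    constructor <;> linarith
  rw [e, abs_mul, abs_of_pos Real.two_pi_pos]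
  nlinarith [Real.two_pi_pos]

theorem Compatible.sum_angleDiff {M : ℕ} {X : Fin M → ℝ → ℂ} (hX : Compatible M X) {t : ℝ}
    (ht : 0 < t) (m : Fin M) :
    ∑ k, X k t * Complex.exp (-(Complex.I * angleDiff M k m)) = 0 := by
  have h := (hX t ht).1
  have e : ∀ k, X k t * Complex.exp (-(Complex.I * angleDiff M k m))
      = Complex.exp (Complex.I * angle M m) * (X k t * Complex.exp (-Complex.I * angle M k)) := by
    intro k
    rw [mul_left_comm, ← Complex.exp_add, angleDiff]
    congr 2
    push_cast; ring
  simp only [e, ← Finset.mul_sum, h, mul_zero]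

/-- A mode depends on the angle only through `θ - θ_k`, so the shift by `Δ_{km}` replaces `θ_k` by
`θ_m`. -/
theorem mode_add_angleDiff (a g μ α : ℝ) (hg : g ≠ 0) {M : ℕ} (s : ℝ) (k m : Fin M) {t : ℝ}
    (ht : 0 < t) (θ σ : ℝ) :
    mode a g μ α M s k t (σ + θ + angleDiff M k m)
      = mode a g μ α M s m t θ * Complex.exp (s * Complex.I * α * (2 * a * σ)) := by
  rw [mode_eq _ _ _ _ hg _ _ _ _ _ ht, mode_eq _ _ _ _ hg _ _ _ _ _ ht, ← Complex.exp_add,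
    angleDiff]
  congr 1
  push_cast; ring

theorem add_I_ne_zero (a : ℝ) : (a + Complex.I) ≠ 0 := fun h => by
  simpa using congrArg Complex.im h

/-- The exponent `a (1 + 2 i s α) / (a + i) = i B`. -/
noncomputable def spiralExponent (a α s : ℝ) : ℂ :=
  a * (1 + 2 * Complex.I * s * α) / (a + Complex.I)

theorem spiralExponent_mul (a α s : ℝ) :
    spiralExponent a α s * (a + Complex.I) = a * (1 + 2 * Complex.I * s * α) :=
  div_mul_cancel₀ _ (add_I_ne_zero a)

theorem expB_eq (a α s : ℝ) : expB a α s = -(Complex.I * spiralExponent a α s) := by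
  have h1 := add_I_ne_zero a
  have h2 : (1 + (a : ℂ) ^ 2) ≠ 0 := by
    have : (0 : ℝ) < 1 + a ^ 2 := by positivity
    exact_mod_cast this.ne'
  unfold expB spiralExponent
  field_simp
  linear_combination (-(1 + s * 2 * Complex.I * α) * (a : ℂ) ^ 2) * (Complex.I_sq)

/-- In `n (a + i) = a (1 + 2isα)` the real part forces `n = 1`, and then the imaginary part forces
`2asα = 1`. -/
theorem spiralExponent_ne_int {a α s : ℝ} (ha : 0 < a) (h : 2 * a * s * α ≠ 1) (n : ℤ) :
    spiralExponent a α s ≠ n := by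
  intro hn
  have e := spiralExponent_mul a α s
  rw [hn] at e
  have hre := congrArg Complex.re e
  have him := congrArg Complex.im e
  simp at hre him
  have h1 : (n : ℝ) = 1 := mul_right_cancel₀ ha.ne' (by linarith)
  exact h (by linarith)

theorem exp_spiralExponent_ne_one {a α s : ℝ} (ha : 0 < a) (h : 2 * a * s * α ≠ 1) :
    Complex.exp (2 * Real.pi * Complex.I * spiralExponent a α s) ≠ 1 := by
  intro he
  obtain ⟨n, hn⟩ := Complex.exp_eq_one_iff.1 he
  refine spiralExponent_ne_int ha h n (mul_left_cancel₀ Complex.two_pi_I_ne_zero ?_)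
  linear_combination hn

/-- As `q = e^{-2πB}`, the fraction is `coth (πB)`, and `coth (πB) ∓ 1 = e^{∓πB} / sinh (πB)`
accounts for the nonzero signs of `Δ_{km}`. -/
theorem coeffC_eq {a α s : ℝ} (ha : 0 < a) (h : 2 * a * s * α ≠ 1) {M : ℕ} (m k : Fin M) :
    coeffC a α M s m k = a / (a + Complex.I) * spiralExponent a α s
      * Complex.exp (-(Complex.I * spiralExponent a α s * angleDiff M k m))
      * ((1 + Complex.exp (2 * Real.pi * Complex.I * spiralExponent a α s))
        / (1 - Complex.exp (2 * Real.pi * Complex.I * spiralExponent a α s))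
          - (SignType.sign (angleDiff M k m) : ℝ)) := by
  have hq := exp_spiralExponent_ne_one ha h
  set B := expB a α s with hB
  have hβB : Complex.I * spiralExponent a α s = -B := by rw [hB, expB_eq]; ring
  have e1 : 2 * Real.pi * Complex.I * spiralExponent a α s
      = -Real.pi * B + -Real.pi * B := by linear_combination (2 * (Real.pi : ℂ)) * hβB
  rw [e1, Complex.exp_add] at hq ⊢
  rw [hβB]
  have hp := add_I_ne_zero a
  have hpre : (a : ℂ) / (a + Complex.I) * spiralExponent a α s
      = (a : ℂ) ^ 2 * (s * 2 * Complex.I * α + 1) / (a + Complex.I) ^ 2 := by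
    unfold spiralExponent; field_simp; ring
  rw [hpre, coeffC, ← hB, mul_assoc _ _ (_ - _)]
  congr 1
  rw [show -(-B * (angleDiff M k m : ℂ)) = angleDiff M k m * B by ring, coeffB, ← hB,
    mul_div_assoc]
  congr 1
  rw [Complex.sinh, Complex.cosh, ← neg_mul]
  set u := Complex.exp (Real.pi * B) with hu
  set w := Complex.exp (-Real.pi * B) with hw
  have huw : u * w = 1 := by rw [hu, hw, ← Complex.exp_add]; simp
  have hw0 : w ≠ 0 := Complex.exp_ne_zero _
  have hu' : u = w⁻¹ := eq_inv_of_mul_eq_one_left huw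
  have h1 : 1 - w * w ≠ 0 := sub_ne_zero.2 hq.symm
  have h2 : 1 - w ^ 2 ≠ 0 := by rwa [pow_two]
  rw [hu', show w⁻¹ - w = (1 - w ^ 2) / w by field_simp]
  rcases lt_trichotomy (angleDiff M k m) 0 with h | h | h
  · rw [if_neg h.not_gt, if_neg h.ne, sign_neg h, SignType.coe_neg_one]
    push_cast
    field_simp
    ring
  · rw [if_neg h.not_gt, if_pos h, h, sign_zero, SignType.coe_zero]
    push_cast
    field_simp
    ring
  · rw [if_pos h, sign_pos h, SignType.coe_one]
    push_cast
    field_simp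
    ring

theorem offDiagIntegrand_term (a g μ α : ℝ) (hg : g ≠ 0) {M : ℕ} (s : ℝ) (k m : Fin M) {t : ℝ}
    (ht : 0 < t) (θ σ : ℝ) (x : ℂ) :
    x * mode a g μ α M s k t (σ + θ + angleDiff M k m)
        * Complex.exp (Complex.I * (σ + θ + angleDiff M k m : ℝ)) * Complex.exp (2 * a * σ)
        * Complex.exp (-2 * Complex.I * θ)
      / (1 - Complex.exp ((a + Complex.I) * σ) * Complex.exp (Complex.I * angleDiff M k m)) ^ 2
    = mode a g μ α M s m t θ * Complex.exp (-Complex.I * θ) / (a + Complex.I)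
      * (x * Complex.exp (-(Complex.I * spiralExponent a α s * angleDiff M k m))
        * ((a + Complex.I) * kernel (spiralExponent a α s)
          ((a + Complex.I) * σ + Complex.I * angleDiff M k m))) := by
  have hp := add_I_ne_zero a
  have hβ := spiralExponent_mul a α s
  rw [mode_add_angleDiff _ _ _ _ hg _ _ _ ht, kernel, ← Complex.exp_add]
  have e : Complex.exp (s * Complex.I * α * (2 * a * σ))
      * Complex.exp (Complex.I * (σ + θ + angleDiff M k m : ℝ)) * Complex.exp (2 * a * σ)
        * Complex.exp (-2 * Complex.I * θ)
      = Complex.exp (-Complex.I * θ)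
        * Complex.exp (-(Complex.I * spiralExponent a α s * angleDiff M k m))
        * Complex.exp ((spiralExponent a α s + 1)
          * ((a + Complex.I) * σ + Complex.I * angleDiff M k m)) := by
    simp only [← Complex.exp_add]
    congr 1
    push_cast
    -- The coefficient of `σ` is `2iasα + i + 2a = (β + 1)(a + i)`.
    linear_combination -(σ : ℂ) * hβ
  rw [show x * (mode a g μ α M s m t θ * Complex.exp (s * Complex.I * α * (2 * a * σ)))
        * Complex.exp (Complex.I * (σ + θ + angleDiff M k m : ℝ)) * Complex.exp (2 * a * σ)
        * Complex.exp (-2 * Complex.I * θ)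
      = x * mode a g μ α M s m t θ * (Complex.exp (s * Complex.I * α * (2 * a * σ))
        * Complex.exp (Complex.I * (σ + θ + angleDiff M k m : ℝ)) * Complex.exp (2 * a * σ)
        * Complex.exp (-2 * Complex.I * θ)) by ring, e]
  field_simp

theorem offDiagIntegrand_perturbation (a g μ α : ℝ) (hg : g ≠ 0) {M : ℕ} (X Y : Fin M → ℝ → ℂ)
    (m : Fin M) {t : ℝ} (ht : 0 < t) (θ : ℝ) :
    offDiagIntegrand a M (fun k => perturbation a g μ α M X Y k t) m θ = fun σ =>
      mode a g μ α M 1 m t θ * Complex.exp (-Complex.I * θ) / (a + Complex.I)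
        * kernelSum a (spiralExponent a α 1) (fun k => X k t) (fun k => angleDiff M k m) σ
      + mode a g μ α M (-1) m t θ * Complex.exp (-Complex.I * θ) / (a + Complex.I)
        * kernelSum a (spiralExponent a α (-1)) (fun k => Y k t)
          (fun k => angleDiff M k m) σ := by
  funext σ
  rw [offDiagIntegrand, kernelSum, kernelSum, Finset.mul_sum, Finset.mul_sum,
    ← Finset.sum_add_distrib]
  refine Finset.sum_congr rfl fun k _ => ?_
  rw [← offDiagIntegrand_term a g μ α hg 1 k m ht θ σ (X k t),
    ← offDiagIntegrand_term a g μ α hg (-1) k m ht θ σ (Y k t), ← add_div, perturbation]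
  congr 1
  ring

theorem hasFinitePartLine_mode {a α s : ℝ} (ha : 0 < a) (h : 2 * a * s * α ≠ 1) {M : ℕ}
    {X : Fin M → ℝ → ℂ} (hX : Compatible M X) (m : Fin M) {t : ℝ} (ht : 0 < t) :
    HasFinitePartLine
      (kernelSum a (spiralExponent a α s) (fun k => X k t) (fun k => angleDiff M k m)) 0
      (Real.pi * Complex.I * (a + Complex.I) / a * ∑ k, X k t * coeffC a α M s m k) := by
  have hp := add_I_ne_zero a
  have ha0 : (a : ℂ) ≠ 0 := by exact_mod_cast ha.ne'
  convert! hasFinitePartLine_kernelSum ha (β := spiralExponent a α s)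
    (by rw [spiralExponent_mul]; simp)
    (by exact_mod_cast spiralExponent_ne_int ha h 1)
    (exp_spiralExponent_ne_one ha h) (fun k => X k t) (fun k => abs_angleDiff_lt k m)
    (hX.sum_angleDiff ht m) using 1
  rw [Finset.mul_sum]
  refine Finset.sum_congr rfl fun k _ => ?_
  rw [coeffC_eq ha h]
  field_simp

end LogSpiral

theorem proposition3p2 (M : ℕ) (hM : 3 ≤ M) (a g μ α : ℝ) (ha : 0 < a) (hg : g ≠ 0)
    (hα : 0 < α) (hα' : α ≠ 1 / (2 * a)) (X Y : Fin M → ℝ → ℂ)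
    (hX : LogSpiral.Compatible M X) (hY : LogSpiral.Compatible M Y)
    (m : Fin M) (t θ : ℝ) (ht : 0 < t) :
    (∃ L : ℂ, LogSpiral.HasFinitePartLine
      (LogSpiral.offDiagIntegrand a M
        (fun k => LogSpiral.perturbation a g μ α M X Y k t) m θ) 0 L) ∧
    LogSpiral.offDiagOp a g M (fun k => LogSpiral.perturbation a g μ α M X Y k t) m θ =
      LogSpiral.mode a g μ α M 1 m t θ * Complex.exp (-Complex.I * θ) * g
          * ∑ k : Fin M, X k t * LogSpiral.coeffC a α M 1 m k
        + LogSpiral.mode a g μ α M (-1) m t θ * Complex.exp (-Complex.I * θ) * g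
          * ∑ k : Fin M, Y k t * LogSpiral.coeffC a α M (-1) m k := by
  have h1 : 2 * a * 1 * α ≠ 1 := fun h => hα' (by field_simp; linarith)
  -- For the minus mode the left side is negative, so only the plus mode can be resonant.
  have h2 : 2 * a * (-1) * α ≠ 1 := fun h => by nlinarith [mul_pos ha hα]
  have hδ := fun k => LogSpiral.abs_angleDiff_lt k m
  have hXp := (LogSpiral.hasFinitePartLine_mode ha h1 hX m ht).const_mul
    (LogSpiral.mode a g μ α M 1 m t θ * Complex.exp (-Complex.I * θ) / (a + Complex.I))
  have hYp := (LogSpiral.hasFinitePartLine_mode ha h2 hY m ht).const_mul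
    (LogSpiral.mode a g μ α M (-1) m t θ * Complex.exp (-Complex.I * θ) / (a + Complex.I))
  have hline := LogSpiral.HasFinitePartLine.add
    (by exact continuousOn_const.mul (LogSpiral.continuousOn_kernelSum ha _ _ hδ))
    (by exact continuousOn_const.mul (LogSpiral.continuousOn_kernelSum ha _ _ hδ)) hXp hYp
  rw [LogSpiral.offDiagOp, LogSpiral.offDiagIntegrand_perturbation a g μ α hg X Y m ht θ]
  refine ⟨⟨_, hline⟩, ?_⟩
  rw [hline.finitePartLine_eq]
  have hp := LogSpiral.add_I_ne_zero a
  have ha0 : (a : ℂ) ≠ 0 := by exact_mod_cast ha.ne'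
  have hpi : (Real.pi : ℂ) ≠ 0 := by exact_mod_cast Real.pi_ne_zero
  field_simp
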